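/- Let $d\in\{1,2\}$, $\alpha>d$, $h\neq 0$, $\mu>0$, $\sigma^2\ge 0$ and $T>0$. For each density $\lambda>0$ let the base stations (BSs) of a network be the points of a homogeneous Poisson point process $\Phi$ of intensity $\lambda$ in $\mathbb{R}^d$, and let the fading powers $(g_x)_{x\in\Phi}$ be i.i.d. exponential random variables with mean $1/\mu$ (Rayleigh fading), independent of the locations. Let the path loss at horizontal distance $r$ be $l_1(r)=(h^2+r^2)^{-\alpha/2}$, where $h$ is the difference between the BS and user antenna heights. A user at a fixed location $u_0\in\mathbb{R}^d$ is served by its closest BS $b_0$, and $$\mathrm{SINR}=\frac{g_{b_0}\,l_1(\|b_0-u_0\|)}{\sum_{x\in\Phi\setminus\{b_0\}}g_x\,l_1(\|x-u_0\|)+\sigma^2}.$$ Then the coverage probability $p_c(T,\lambda,\alpha)=\mathbb{P}(\mathrm{SINR}>T)$ satisfies $$\lim_{\lambda\to\infty}p_c(T,\lambda,\alpha)=0 .$$ In particular SINR invariance fails for every nonzero antenna height difference $h$: the function $\lambda\mapsto p_c(T,\lambda,\alpha)$ is not constant on $(0,\infty)$. -/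

import Mathlib

open MeasureTheory ProbabilityTheory Filter Topology
open scoped ENNReal NNReal

namespace CellularNetwork

noncomputable section

/-- The number of points of the configuration `x` (counted with multiplicity) lying in `B`. -/
def pointCount {E : Type*} (x : ℕ → E) (B : Set E) : ℕ∞ :=
  {n : ℕ | x n ∈ B}.encard

/-- `X` is (a measurable enumeration of) a homogeneous Poisson point process of density `lam` in
`ℝ^d`: the number of points in a measurable set `B` of finite volume is Poisson distributed with
mean `lam * vol B`, and the numbers of points in pairwise disjoint sets are independent.
As the total intensity is infinite, there are almost surely infinitely many points, so `ℕ` is the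
right index set. -/
structure IsPoissonPointProcess {d : ℕ} {Ω : Type*} [MeasurableSpace Ω] (P : Measure Ω)
    (lam : ℝ) (X : ℕ → Ω → EuclideanSpace ℝ (Fin d)) : Prop where
  measurable : ∀ n, Measurable (X n)
  count_hasLaw : ∀ B : Set (EuclideanSpace ℝ (Fin d)), MeasurableSet B → volume B < ⊤ →
    HasLaw (fun ω => pointCount (fun n => X n ω) B)
      ((poissonMeasure (Real.toNNReal (lam * volume.real B))).map (Nat.cast : ℕ → ℕ∞)) P
  count_indep : ∀ (k : ℕ) (B : Fin k → Set (EuclideanSpace ℝ (Fin d))),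
    (∀ i, MeasurableSet (B i)) → (∀ i, volume (B i) < ⊤) → Pairwise (Function.onFun Disjoint B) →
    iIndepFun (fun i ω => pointCount (fun n => X n ω) (B i)) P

/-- The irregular network of density `lam` with Rayleigh fading: the base station locations `X`
form a homogeneous Poisson point process of density `lam`, and the fading powers `g n` of the
base stations are i.i.d. exponential with rate `μ` (mean `1 / μ`), independent of the locations. -/
structure IsIrregularRayleighNetwork {d : ℕ} {Ω : Type*} [MeasurableSpace Ω] (P : Measure Ω)
    (lam μ : ℝ) (X : ℕ → Ω → EuclideanSpace ℝ (Fin d)) (g : ℕ → Ω → ℝ) : Prop where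
  locations : IsPoissonPointProcess P lam X
  fading_measurable : ∀ n, Measurable (g n)
  fading_law : ∀ n, HasLaw (g n) (expMeasure μ) P
  fading_indep : iIndepFun g P
  fading_indep_locations : IndepFun (fun ω n => X n ω) (fun ω n => g n ω) P

/-- The path-loss function `l₁(r) = (h² + r²)^(-α/2)` with antenna height difference `h`. -/
def pathLoss (h α r : ℝ) : ℝ := (h ^ 2 + r ^ 2) ^ (-α / 2)

/-- The (index of the) serving base station of a user at `u`: the closest one, i.e. the one with
the strongest average received power (ties, which have probability zero, are broken by the index;
a closest base station exists for every infinite locally finite configuration). -/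
def servingBS {E : Type*} [NormedAddCommGroup E] (u : E) (x : ℕ → E) : ℕ :=
  sInf {n : ℕ | ∀ m, ‖x n - u‖ ≤ ‖x m - u‖}

/-- The interference at a user at `u`: the total power received, under the path-loss function `l`,
from all base stations except the serving one. -/
def interference {E : Type*} [NormedAddCommGroup E] (l : ℝ → ℝ) (u : E) (x : ℕ → E)
    (g : ℕ → ℝ) : ℝ≥0∞ :=
  ∑' n : {n : ℕ // n ≠ servingBS u x}, ENNReal.ofReal (g n * l ‖x n - u‖)

/-- The signal to interference plus noise ratio of a user at `u`, with noise power `σ ^ 2`. -/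
def SINR {E : Type*} [NormedAddCommGroup E] (l : ℝ → ℝ) (σ : ℝ) (u : E) (x : ℕ → E)
    (g : ℕ → ℝ) : ℝ≥0∞ :=
  ENNReal.ofReal (g (servingBS u x) * l ‖x (servingBS u x) - u‖) /
    (interference l u x g + ENNReal.ofReal (σ ^ 2))

/-- The coverage probability `ℙ(SINR > T)` of a user at `u`. -/
def coverageProb {d : ℕ} {Ω : Type*} [MeasurableSpace Ω] (P : Measure Ω) (l : ℝ → ℝ) (σ : ℝ)
    (u : EuclideanSpace ℝ (Fin d)) (X : ℕ → Ω → EuclideanSpace ℝ (Fin d)) (g : ℕ → Ω → ℝ)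
    (T : ℝ) : ℝ :=
  P.real {ω | ENNReal.ofReal T < SINR l σ u (fun n => X n ω) (fun n => g n ω)}

/-- SINR invariance: the coverage probability, as a function of the density, is constant. -/
def SINRInvariant (p : ℝ → ℝ) : Prop :=
  ∃ c : ℝ, ∀ lam : ℝ, 0 < lam → p lam = c

end

end CellularNetwork

/-!
Because `h ≠ 0`, the path loss is bounded above by its value at distance `0`, so a dense network
brings ever more interferers close to the user without improving the signal correspondingly.

For the limit, fix the station locations and suppose that more than `k` stations lie within
distance `1` of the user. If the user is covered, then either the fading of the serving station
exceeds a level `M`, or the fadings of `k` other stations all stay below a level `K` depending only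
on `M` (`measure_lt_SINR_le`). The first event is rare for large `M`, and, once `M` is fixed, the
second has probability `q ^ k` with `q < 1`. Since locations and fadings are independent, this may
be averaged over the locations, and for large density the Poisson number of stations within
distance `1` exceeds `k` with probability close to `1`.

If the coverage probability were constant in the density, the constant would therefore be `0`.
It is positive, however, for every density (`IsIrregularRayleighNetwork.coverageProb_pos`): as
`α > d`, the path loss is integrable, so by Campbell's formula the sum of the path losses, and with
it the interference, is almost surely finite
(`IsPoissonPointProcess.ae_tsum_pathLoss_ne_top`). The interference is independent of the fading of
the serving station, which exceeds any given level with positive probability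
(`measure_lt_SINR_ne_zero`).
-/

namespace CellularNetwork

/-! ### Poisson and exponential laws -/

/-- The mean of the Poisson law with rate `r` is `r`. -/
theorem lintegral_natCast_poissonMeasure (r : ℝ≥0) :
    ∫⁻ n : ℕ, (n : ℝ≥0∞) ∂(poissonMeasure r) = r := by
  have hshift : ∀ n : ℕ, (poissonMeasure r {n + 1}) * ((n + 1 : ℕ) : ℝ≥0∞)
      = r * poissonMeasure r {n} := by
    intro n
    rw [poissonMeasure_singleton, poissonMeasure_singleton, ← ENNReal.ofReal_natCast,
      ← ENNReal.ofReal_coe_nnreal, ← ENNReal.ofReal_mul (by positivity),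
      ← ENNReal.ofReal_mul (by positivity)]
    congr 1
    rw [Nat.factorial_succ]
    push_cast
    field_simp
    ring
  have hone : ∑' n : ℕ, poissonMeasure r {n} = 1 := by
    have := lintegral_countable' (μ := poissonMeasure r) (fun _ : ℕ => (1 : ℝ≥0∞))
    simpa using this.symm
  rw [lintegral_countable', tsum_eq_zero_add' ENNReal.summable]
  simp_rw [mul_comm _ (poissonMeasure r _), hshift, ENNReal.tsum_mul_left, hone]
  simp

theorem tendsto_poissonMeasure_Iic_atTop (k : ℕ) :
    Tendsto (fun r : ℝ≥0 => poissonMeasure r (Set.Iic k)) atTop (𝓝 0) := by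
  have hsum : ∀ r : ℝ≥0, poissonMeasure r (Set.Iic k)
      = ∑ n ∈ Finset.Iic k, poissonMeasure r {n} := by
    intro r
    rw [sum_measure_singleton, Finset.coe_Iic]
  simp_rw [hsum, poissonMeasure_singleton]
  rw [show (0 : ℝ≥0∞) = ∑ n ∈ Finset.Iic k, ENNReal.ofReal 0 by simp]
  refine tendsto_finsetSum _ fun n _ => ENNReal.tendsto_ofReal ?_
  have h := ((Real.tendsto_pow_mul_exp_neg_atTop_nhds_zero n).comp
    (NNReal.tendsto_coe_atTop.2 tendsto_id)).div_const (n.factorial : ℝ)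
  simpa [mul_comm, Function.comp_def] using h

theorem expMeasure_Ioi {μ : ℝ} (hμ : 0 < μ) {M : ℝ} (hM : 0 ≤ M) :
    expMeasure μ (Set.Ioi M) = ENNReal.ofReal (Real.exp (-(μ * M))) := by
  have := isProbabilityMeasure_expMeasure hμ
  have h := cdf_expMeasure_eq hμ M
  rw [if_pos hM, cdf_eq_real] at h
  rw [← Set.compl_Iic, ← ofReal_measureReal, probReal_compl_eq_one_sub measurableSet_Iic, h]
  simp

theorem lintegral_ofReal_expMeasure_ne_top {μ : ℝ} (hμ : 0 < μ) :
    ∫⁻ x, ENNReal.ofReal x ∂(expMeasure μ) ≠ ⊤ := by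
  have hmeas : Measurable (exponentialPDF μ) := (measurable_exponentialPDFReal μ).ennreal_ofReal
  have hle : ∫⁻ x, ENNReal.ofReal x ∂(expMeasure μ)
      ≤ ∫⁻ x, ENNReal.ofReal (4 / μ) * exponentialPDF (μ / 2) x := by
    change ∫⁻ x, ENNReal.ofReal x ∂(volume.withDensity (exponentialPDF μ)) ≤ _
    rw [lintegral_withDensity_eq_lintegral_mul _ hmeas ENNReal.measurable_ofReal]
    refine lintegral_mono fun x => ?_
    rcases lt_or_ge x 0 with hx | hx
    · simp [exponentialPDF_of_neg hx]
    · simp only [Pi.mul_apply, exponentialPDF_of_nonneg hx]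
      rw [← ENNReal.ofReal_mul (by positivity), ← ENNReal.ofReal_mul (by positivity)]
      refine ENNReal.ofReal_le_ofReal ?_
      -- Half of the exponential decay absorbs the factor `x`, which leaves a multiple of the density
      -- with rate `μ / 2`.
      have h1 : μ / 2 * x ≤ Real.exp (μ / 2 * x) := by
        linarith [Real.add_one_le_exp (μ / 2 * x)]
      have h2 : Real.exp (-(μ * x)) * Real.exp (μ / 2 * x) = Real.exp (-(μ / 2 * x)) := by
        rw [← Real.exp_add]; ring_nf
      have h3 : 4 / μ * (μ / 2 * Real.exp (-(μ / 2 * x))) = 2 * Real.exp (-(μ / 2 * x)) := by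
        field_simp; norm_num
      rw [h3, ← h2]
      nlinarith [Real.exp_pos (-(μ * x))]
  refine ne_top_of_le_ne_top ?_ hle
  rw [lintegral_const_mul' _ _ ENNReal.ofReal_ne_top,
    lintegral_exponentialPDF_eq_one (by positivity)]
  simp

/-! ### The path loss and measurability of the SINR -/

theorem measurable_pathLoss (h α : ℝ) : Measurable (pathLoss h α) := by
  unfold pathLoss; fun_prop

theorem pathLoss_pos {h : ℝ} (hh : h ≠ 0) (α r : ℝ) : 0 < pathLoss h α r := by
  unfold pathLoss; positivity

theorem pathLoss_anti {h α : ℝ} (hh : h ≠ 0) (hα : 0 ≤ α) {r s : ℝ} (hr : 0 ≤ r)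
    (hrs : r ≤ s) : pathLoss h α s ≤ pathLoss h α r := by
  unfold pathLoss
  exact Real.rpow_le_rpow_of_nonpos (by positivity) (by gcongr) (by linarith)

/-- The only place where `d < α` enters: beyond any bounded region the path loss decays like
`‖x‖ ^ (-α)`. Rescaling by `h` reduces the claim to `(1 + ‖x‖²) ^ (-α / 2)`. -/
theorem integrable_pathLoss {d : ℕ} {h α : ℝ} (hh : h ≠ 0) (hα : (d : ℝ) < α)
    (u : EuclideanSpace ℝ (Fin d)) :
    Integrable (fun x : EuclideanSpace ℝ (Fin d) => pathLoss h α ‖x - u‖) := by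
  have h1 : Integrable (fun x : EuclideanSpace ℝ (Fin d) => ((1 : ℝ) + ‖x‖ ^ 2) ^ (-α / 2)) :=
    integrable_rpow_neg_one_add_norm_sq (by simpa using hα)
  have h2 := ((h1.comp_smul (inv_ne_zero hh)).comp_sub_right u).const_mul ((h ^ 2) ^ (-α / 2))
  refine h2.congr (Eventually.of_forall fun x => ?_)
  simp only [pathLoss]
  rw [← Real.mul_rpow (by positivity) (by positivity), norm_smul, mul_pow, norm_inv, inv_pow,
    Real.norm_eq_abs, sq_abs]
  congr 1
  field_simp

/-- The configurations without a closest station need a separate case: there `servingBS` is the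
junk value `sInf ∅ = 0`. -/
theorem measurable_servingBS {E : Type*} [NormedAddCommGroup E] [MeasurableSpace E]
    [BorelSpace E] [SecondCountableTopology E] (u : E) :
    Measurable (servingBS u : (ℕ → E) → ℕ) := by
  have hset : ∀ n, MeasurableSet {x : ℕ → E | ∀ m, ‖x n - u‖ ≤ ‖x m - u‖} := fun n => by
    simp only [Set.ofPred_forall]
    exact MeasurableSet.iInter fun m => measurableSet_le (by fun_prop) (by fun_prop)
  refine measurable_of_Iic fun k => ?_
  have : servingBS u ⁻¹' Set.Iic k = (⋃ n ∈ Set.Iic k, {x : ℕ → E | ∀ m, ‖x n - u‖ ≤ ‖x m - u‖})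
      ∪ ⋂ n, {x : ℕ → E | ∀ m, ‖x n - u‖ ≤ ‖x m - u‖}ᶜ := by
    ext x
    simp only [Set.mem_preimage, Set.mem_Iic, Set.mem_union, Set.mem_iUnion, Set.mem_iInter,
      Set.mem_compl_iff, exists_prop, servingBS]
    constructor
    · intro hx
      by_cases hne : {n : ℕ | ∀ m, ‖x n - u‖ ≤ ‖x m - u‖}.Nonempty
      · exact Or.inl ⟨_, hx, Nat.sInf_mem hne⟩
      · exact Or.inr fun n hn => hne ⟨n, hn⟩
    · rintro (⟨n, hn, hx⟩ | hx)
      · exact (Nat.sInf_le hx).trans hn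
      · have : {n : ℕ | ∀ m, ‖x n - u‖ ≤ ‖x m - u‖} = ∅ :=
          Set.eq_empty_of_forall_notMem hx
        simp [this]
  rw [this]
  exact (MeasurableSet.biUnion (Set.to_countable _) fun n _ => hset n).union
    (MeasurableSet.iInter fun n => (hset n).compl)

theorem measurable_SINR {E : Type*} [NormedAddCommGroup E] [MeasurableSpace E]
    [BorelSpace E] [SecondCountableTopology E] {l : ℝ → ℝ} (hl : Measurable l) (σ : ℝ) (u : E) :
    Measurable (fun p : (ℕ → E) × (ℕ → ℝ) => SINR l σ u p.1 p.2) := by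
  -- The index of the serving station takes countably many values, so it may be frozen.
  have hfix : Measurable (fun q : ((ℕ → E) × (ℕ → ℝ)) × ℕ =>
      ENNReal.ofReal (q.1.2 q.2 * l ‖q.1.1 q.2 - u‖) /
        ((∑' n : {n : ℕ // n ≠ q.2}, ENNReal.ofReal (q.1.2 n * l ‖q.1.1 n - u‖))
          + ENNReal.ofReal (σ ^ 2))) := by
    refine measurable_from_prod_countable_left fun b => ?_
    have hterm : ∀ n : ℕ, Measurable (fun p : (ℕ → E) × (ℕ → ℝ) =>
        ENNReal.ofReal (p.2 n * l ‖p.1 n - u‖)) := fun n => by fun_prop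
    have hsum : Measurable (fun p : (ℕ → E) × (ℕ → ℝ) =>
        ∑' n : {n : ℕ // n ≠ b}, ENNReal.ofReal (p.2 n * l ‖p.1 n - u‖)) :=
      Measurable.tsum fun n => hterm n
    exact (hterm b).div (hsum.add_const _)
  exact hfix.comp (measurable_id.prodMk ((measurable_servingBS u).comp measurable_fst))

/-! ### Conditioning on an independent variable -/

/-- For independent `Y` and `Z`, an event about `(Y, Z)` may be computed by freezing the value of
`Y` and averaging over it. -/
theorem measure_prodMk_mem_eq_lintegral {Ω α β : Type*} [MeasurableSpace Ω] [MeasurableSpace α]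
    [MeasurableSpace β] {P : Measure Ω} [IsProbabilityMeasure P] {Y : Ω → α} {Z : Ω → β}
    (hY : Measurable Y) (hZ : Measurable Z) (hYZ : IndepFun Y Z P) {S : Set (α × β)}
    (hS : MeasurableSet S) :
    P {ω | (Y ω, Z ω) ∈ S} = ∫⁻ ω, P {ω' | (Y ω, Z ω') ∈ S} ∂P := by
  have hprod := (indepFun_iff_map_prod_eq_prod_map_map hY.aemeasurable hZ.aemeasurable).1 hYZ
  have h1 : P {ω | (Y ω, Z ω) ∈ S} = P.map (fun ω => (Y ω, Z ω)) S :=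
    (Measure.map_apply (hY.prodMk hZ) hS).symm
  have : IsProbabilityMeasure (P.map Z) := Measure.isProbabilityMeasure_map hZ.aemeasurable
  rw [h1, hprod, Measure.prod_apply hS, lintegral_map (measurable_measure_prodMk_left hS) hY]
  refine lintegral_congr fun ω => ?_
  rw [Measure.map_apply hZ (measurable_prodMk_left hS)]
  rfl

/-! ### First moments of the Poisson process -/

/-- The intensity measure of the process is at most `lam` times the volume. -/
theorem IsPoissonPointProcess.tsum_measure_preimage_le {d : ℕ} {Ω : Type*} [MeasurableSpace Ω]
    {P : Measure Ω} {lam : ℝ} (hlam : 0 < lam) {X : ℕ → Ω → EuclideanSpace ℝ (Fin d)}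
    (hX : IsPoissonPointProcess P lam X) {B : Set (EuclideanSpace ℝ (Fin d))}
    (hB : MeasurableSet B) :
    ∑' n, P (X n ⁻¹' B) ≤ ENNReal.ofReal lam * volume B := by
  -- For infinite volume the right-hand side is infinite, as `lam > 0`.
  rcases eq_or_ne (volume B) ⊤ with htop | htop
  · simp [htop, ENNReal.mul_top, hlam]
  have hcount : ∀ ω, ((pointCount (fun n => X n ω) B : ℕ∞) : ℝ≥0∞)
      = ∑' n, (X n ⁻¹' B).indicator 1 ω := by
    intro ω
    rw [pointCount, ← ENNReal.tsum_set_one, tsum_subtype _ (fun _ => (1 : ℝ≥0∞))]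
    rfl
  calc ∑' n, P (X n ⁻¹' B) = ∑' n, ∫⁻ ω, (X n ⁻¹' B).indicator 1 ω ∂P := by
        simp_rw [lintegral_indicator_one (hX.measurable _ hB)]
    _ = ∫⁻ ω, ((pointCount (fun n => X n ω) B : ℕ∞) : ℝ≥0∞) ∂P := by
        simp_rw [hcount]
        rw [lintegral_tsum fun n =>
          (measurable_one.indicator (hX.measurable n hB)).aemeasurable]
    _ = ∫⁻ m : ℕ∞, (m : ℝ≥0∞) ∂((poissonMeasure (Real.toNNReal (lam * volume.real B))).map
          (Nat.cast : ℕ → ℕ∞)) :=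
        (hX.count_hasLaw B hB htop.lt_top).lintegral_comp
          (f := fun m : ℕ∞ => (m : ℝ≥0∞)) (measurable_of_countable _).aemeasurable
    _ = ∫⁻ n : ℕ, (n : ℝ≥0∞) ∂(poissonMeasure (Real.toNNReal (lam * volume.real B))) := by
        rw [lintegral_map (measurable_of_countable _) (measurable_of_countable _)]
        simp
    _ = ENNReal.ofReal (lam * volume.real B) := lintegral_natCast_poissonMeasure _
    _ ≤ ENNReal.ofReal lam * volume B := by
        rw [ENNReal.ofReal_mul hlam.le, ofReal_measureReal htop]

/-- Campbell's formula, as an inequality. -/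
theorem IsPoissonPointProcess.tsum_lintegral_le {d : ℕ} {Ω : Type*} [MeasurableSpace Ω]
    {P : Measure Ω} {lam : ℝ} (hlam : 0 < lam) {X : ℕ → Ω → EuclideanSpace ℝ (Fin d)}
    (hX : IsPoissonPointProcess P lam X) {f : EuclideanSpace ℝ (Fin d) → ℝ≥0∞}
    (hf : Measurable f) :
    ∑' n, ∫⁻ ω, f (X n ω) ∂P ≤ ENNReal.ofReal lam * ∫⁻ x, f x := by
  have hle : Measure.sum (fun n => P.map (X n)) ≤ ENNReal.ofReal lam • volume := by
    refine Measure.le_iff.2 fun B hB => ?_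
    rw [Measure.sum_apply _ hB]
    simp_rw [Measure.map_apply (hX.measurable _) hB]
    exact hX.tsum_measure_preimage_le hlam hB
  calc ∑' n, ∫⁻ ω, f (X n ω) ∂P = ∫⁻ x, f x ∂(Measure.sum fun n => P.map (X n)) := by
        rw [lintegral_sum_measure]
        simp_rw [lintegral_map hf (hX.measurable _)]
    _ ≤ ∫⁻ x, f x ∂(ENNReal.ofReal lam • volume) := lintegral_mono' hle le_rfl
    _ = ENNReal.ofReal lam * ∫⁻ x, f x := by rw [lintegral_smul_measure]; rfl

theorem IsPoissonPointProcess.ae_tsum_pathLoss_ne_top {d : ℕ} {Ω : Type*} [MeasurableSpace Ω]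
    {P : Measure Ω} {lam : ℝ} (hlam : 0 < lam) {X : ℕ → Ω → EuclideanSpace ℝ (Fin d)}
    (hX : IsPoissonPointProcess P lam X) {h α : ℝ} (hh : h ≠ 0) (hα : (d : ℝ) < α)
    (u : EuclideanSpace ℝ (Fin d)) :
    ∀ᵐ ω ∂P, ∑' n, ENNReal.ofReal (pathLoss h α ‖X n ω - u‖) ≠ ⊤ := by
  have hmeas : Measurable fun x : EuclideanSpace ℝ (Fin d) =>
      ENNReal.ofReal (pathLoss h α ‖x - u‖) :=
    ((measurable_pathLoss h α).comp (by fun_prop)).ennreal_ofReal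
  have hfin : ∫⁻ x : EuclideanSpace ℝ (Fin d), ENNReal.ofReal (pathLoss h α ‖x - u‖) ≠ ⊤ :=
    ((integrable_pathLoss hh hα u).lintegral_lt_top).ne
  have hmeas' : ∀ n, Measurable fun ω => ENNReal.ofReal (pathLoss h α ‖X n ω - u‖) :=
    fun n => hmeas.comp (hX.measurable n)
  have hint : ∫⁻ ω, ∑' n, ENNReal.ofReal (pathLoss h α ‖X n ω - u‖) ∂P ≠ ⊤ := by
    rw [lintegral_tsum fun n => (hmeas' n).aemeasurable]
    exact ne_top_of_le_ne_top (ENNReal.mul_ne_top ENNReal.ofReal_ne_top hfin)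
      (hX.tsum_lintegral_le hlam hmeas)
  filter_upwards [ae_lt_top (Measurable.tsum hmeas') hint] with ω hω using hω.ne

/-! ### Coverage for a fixed configuration -/

/-- If more than `k` stations lie within distance `1` of the user, then coverage forces the serving
station to have fading above `M`, or else each of `k` interferers to have fading at most
`M * L / (T * c)`; here `L` bounds the path loss from above and `c` bounds it from below within
distance `1`. The serving station may be any fixed one: being the closest plays no role. -/
theorem measure_lt_SINR_le {E Ω : Type*} [NormedAddCommGroup E] [MeasurableSpace Ω]
    {P : Measure Ω} {ρ : Measure ℝ} {g : ℕ → Ω → ℝ}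
    (hlaw : ∀ n, HasLaw (g n) ρ P) (hindep : iIndepFun g P) {l : ℝ → ℝ} {L c : ℝ} (hL : 0 < L)
    (hc : 0 < c) (hl0 : ∀ r, 0 ≤ l r) (hlL : ∀ r, l r ≤ L) (hcl : ∀ r, 0 ≤ r → r ≤ 1 → c ≤ l r)
    (σ : ℝ) {T : ℝ} (hT : 0 < T) (u : E) {x : ℕ → E} {k : ℕ}
    (hx : (k : ℕ∞) < pointCount x (Metric.ball u 1)) {M : ℝ} (hM : 0 ≤ M) :
    P {ω | ENNReal.ofReal T < SINR l σ u x (fun n => g n ω)}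
      ≤ ρ (Set.Ioi M) + ρ (Set.Iic (M * L / (T * c))) ^ k := by
  set b := servingBS u x with hb
  set K := M * L / (T * c) with hK
  obtain ⟨A, hA, hAk⟩ : ∃ A ⊆ {n : ℕ | x n ∈ Metric.ball u 1} \ {b}, A.encard = k := by
    refine Set.exists_subset_encard_eq ?_
    have h1 := Set.encard_le_encard_sdiff_add_encard {n : ℕ | x n ∈ Metric.ball u 1} {b}
    rw [Set.encard_singleton] at h1
    exact Order.le_of_lt_add_one (hx.trans_le h1)
  have hAfin : A.Finite := Set.finite_of_encard_eq_coe hAk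
  lift A to Finset ℕ using hAfin
  have hcard : A.card = k := by
    rw [Set.encard_coe_eq_coe_finsetCard] at hAk
    exact_mod_cast hAk
  have hsub : {ω | ENNReal.ofReal T < SINR l σ u x (fun n => g n ω)}
      ⊆ {ω | g b ω ∈ Set.Ioi M} ∪ ⋂ n ∈ A, g n ⁻¹' Set.Iic K := by
    intro ω hω
    rw [Set.mem_union, or_iff_not_imp_left]
    intro hbM
    have hbM : g b ω ≤ M := not_lt.1 hbM
    refine Set.mem_iInter₂.2 fun n hn => ?_
    obtain ⟨hnball, hnb⟩ := hA hn
    have hlt : ENNReal.ofReal T * (interference l u x (fun n => g n ω) + ENNReal.ofReal (σ ^ 2))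
        < ENNReal.ofReal (g b ω * l ‖x b - u‖) := ENNReal.mul_lt_of_lt_div hω
    have hle : ENNReal.ofReal (g n ω * l ‖x n - u‖) ≤ interference l u x (fun n => g n ω) :=
      ENNReal.le_tsum (f := fun n : {n : ℕ // n ≠ b} => ENNReal.ofReal (g n ω * l ‖x n - u‖))
        ⟨n, hnb⟩
    have hlt' : ENNReal.ofReal (T * (g n ω * l ‖x n - u‖))
        < ENNReal.ofReal (g b ω * l ‖x b - u‖) := by
      rw [ENNReal.ofReal_mul hT.le]
      exact (mul_le_mul_right (hle.trans le_self_add) _).trans_lt hlt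
    have hreal : T * (g n ω * l ‖x n - u‖) < g b ω * l ‖x b - u‖ :=
      lt_of_not_ge fun hge => hlt'.not_ge (ENNReal.ofReal_le_ofReal hge)
    rw [Set.mem_preimage, Set.mem_Iic, hK, le_div_iff₀ (by positivity)]
    rcases le_or_gt (g n ω) 0 with hneg | hgpos
    · exact (mul_nonpos_of_nonpos_of_nonneg hneg (by positivity)).trans (by positivity)
    · have hdist : ‖x n - u‖ ≤ 1 := (mem_ball_iff_norm.1 hnball).le
      calc g n ω * (T * c) = T * (g n ω * c) := by ring
        _ ≤ T * (g n ω * l ‖x n - u‖) := by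
            gcongr
            exact hcl _ (norm_nonneg _) hdist
        _ ≤ g b ω * l ‖x b - u‖ := hreal.le
        _ ≤ M * L := mul_le_mul hbM (hlL _) (hl0 _) hM
  calc P {ω | ENNReal.ofReal T < SINR l σ u x (fun n => g n ω)}
      ≤ P {ω | g b ω ∈ Set.Ioi M} + P (⋂ n ∈ A, g n ⁻¹' Set.Iic K) :=
        (measure_mono hsub).trans (measure_union_le _ _)
    _ = ρ (Set.Ioi M) + ρ (Set.Iic K) ^ k := by
        rw [hindep.measure_inter_preimage_eq_mul A fun _ _ => measurableSet_Iic]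
        have h1 : ∀ n, P (g n ⁻¹' Set.Iic K) = ρ (Set.Iic K) := fun n =>
          (hlaw n).measure_eq (p := fun y => y ∈ Set.Iic K) measurableSet_Iic
        have h2 : P {ω | g b ω ∈ Set.Ioi M} = ρ (Set.Ioi M) :=
          (hlaw b).measure_eq (p := fun y => y ∈ Set.Ioi M) measurableSet_Ioi
        simp_rw [h1, h2, Finset.prod_const, hcard]

theorem measurable_interference_of_ne {E Ω : Type*} [NormedAddCommGroup E] {m : MeasurableSpace Ω}
    {g : ℕ → Ω → ℝ} (l : ℝ → ℝ) (u : E) (x : ℕ → E)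
    (hg : ∀ n ≠ servingBS u x, Measurable (g n)) :
    Measurable fun ω => interference l u x (fun n => g n ω) :=
  Measurable.tsum fun n => ((hg n n.2).mul_const _).ennreal_ofReal

/-- If the path losses are summable, the interference is almost surely finite. As it is independent
of the fading of the serving station, whose law has unbounded support, coverage is possible. -/
theorem measure_lt_SINR_ne_zero {E Ω : Type*} [NormedAddCommGroup E] [MeasurableSpace Ω]
    {P : Measure Ω} [IsProbabilityMeasure P] {ρ : Measure ℝ} {g : ℕ → Ω → ℝ}
    (hg : ∀ n, Measurable (g n)) (hlaw : ∀ n, HasLaw (g n) ρ P) (hindep : iIndepFun g P)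
    (hmean : ∫⁻ y, ENNReal.ofReal y ∂ρ ≠ ⊤) (htail : ∀ K, ρ (Set.Ioi K) ≠ 0)
    {l : ℝ → ℝ} (hl : ∀ r, 0 < l r) (σ : ℝ) {T : ℝ} (hT : 0 < T) (u : E) {x : ℕ → E}
    (hx : ∑' n, ENNReal.ofReal (l ‖x n - u‖) ≠ ⊤) :
    P {ω | ENNReal.ofReal T < SINR l σ u x (fun n => g n ω)} ≠ 0 := by
  set b := servingBS u x with hb
  let I : Ω → ℝ≥0∞ := fun ω => interference l u x (fun n => g n ω)
  -- The interference only involves the fading of the stations other than `b`.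
  have hI' : Measurable[⨆ n ∈ ({b}ᶜ : Set ℕ), MeasurableSpace.comap (g n) inferInstance] I := by
    refine measurable_interference_of_ne l u x fun n hn => ?_
    exact (comap_measurable (g n)).mono
      (le_iSup₂_of_le (f := fun n (_ : n ∈ ({b}ᶜ : Set ℕ)) =>
        MeasurableSpace.comap (g n) inferInstance) n hn le_rfl) le_rfl
  have hI : Measurable I := hI'.mono (iSup₂_le fun n _ => (hg n).comap_le) le_rfl
  have hIint : ∫⁻ ω, I ω ∂P ≠ ⊤ := by
    have hterm : ∀ n, ∫⁻ ω, ENNReal.ofReal (g n ω * l ‖x n - u‖) ∂P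
        = (∫⁻ y, ENNReal.ofReal y ∂ρ) * ENNReal.ofReal (l ‖x n - u‖) := fun n => by
      simp_rw [ENNReal.ofReal_mul' (hl _).le]
      rw [lintegral_mul_const' _ _ ENNReal.ofReal_ne_top]
      congr 1
      exact (hlaw n).lintegral_comp (f := ENNReal.ofReal)
        ENNReal.measurable_ofReal.aemeasurable
    have hle : ∀ ω, I ω ≤ ∑' n, ENNReal.ofReal (g n ω * l ‖x n - u‖) := fun ω =>
      ENNReal.tsum_comp_le_tsum_of_injective Subtype.val_injective _
    refine ne_top_of_le_ne_top ?_ (lintegral_mono hle)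
    rw [lintegral_tsum fun n => ((hg n).mul_const _).ennreal_ofReal.aemeasurable]
    simp_rw [hterm, ENNReal.tsum_mul_left]
    exact ENNReal.mul_ne_top hmean hx
  obtain ⟨M, hM⟩ : ∃ M : ℕ, P {ω | I ω ≤ M} ≠ 0 := by
    by_contra! hzero
    have hall : ∀ᵐ ω ∂P, ∀ M : ℕ, ¬ I ω ≤ M := by
      rw [ae_all_iff]
      intro M
      rw [ae_iff]
      simpa using hzero M
    obtain ⟨ω, h1, h2⟩ := (hall.and (ae_lt_top hI hIint)).exists
    obtain ⟨M, hM⟩ := ENNReal.exists_nat_gt h2.ne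
    exact h1 M hM.le
  set K : ℝ := T * (M + σ ^ 2) / l ‖x b - u‖ with hK
  have hind : P ({ω | g b ω ∈ Set.Ioi K} ∩ {ω | I ω ≤ M})
      = P {ω | g b ω ∈ Set.Ioi K} * P {ω | I ω ≤ M} := by
    have h1 := indep_iSup_of_disjoint (fun n => (hg n).comap_le) hindep
      (disjoint_compl_right (a := ({b} : Set ℕ)))
    refine (Indep_iff _ _ P).1 h1 _ _ ?_ (hI' measurableSet_Iic)
    rw [iSup_singleton]
    exact ⟨Set.Ioi K, measurableSet_Ioi, rfl⟩
  have hgb : P {ω | g b ω ∈ Set.Ioi K} ≠ 0 := by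
    rw [(hlaw b).measure_eq (p := fun y => y ∈ Set.Ioi K) measurableSet_Ioi]
    exact htail K
  have hsub : {ω | g b ω ∈ Set.Ioi K} ∩ {ω | I ω ≤ M}
      ⊆ {ω | ENNReal.ofReal T < SINR l σ u x (fun n => g n ω)} := by
    rintro ω ⟨h1, h2⟩
    have h1 : K < g b ω := h1
    have h2 : I ω ≤ M := h2
    change ENNReal.ofReal T < ENNReal.ofReal (g b ω * l ‖x b - u‖) / (I ω + ENNReal.ofReal (σ ^ 2))
    have hfin : I ω + ENNReal.ofReal (σ ^ 2) ≠ ⊤ :=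
      ENNReal.add_ne_top.2 ⟨ne_top_of_le_ne_top (ENNReal.natCast_ne_top M) h2,
        ENNReal.ofReal_ne_top⟩
    rw [hK, div_lt_iff₀ (hl _)] at h1
    have hpos : 0 ≤ T * (M + σ ^ 2) := by positivity
    rw [ENNReal.lt_div_iff_mul_lt (Or.inr ENNReal.ofReal_ne_top) (Or.inl hfin)]
    calc ENNReal.ofReal T * (I ω + ENNReal.ofReal (σ ^ 2))
        ≤ ENNReal.ofReal T * (M + ENNReal.ofReal (σ ^ 2)) := by gcongr
      _ = ENNReal.ofReal (T * (M + σ ^ 2)) := by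
          rw [ENNReal.ofReal_mul hT.le, ENNReal.ofReal_add (by positivity) (by positivity),
            ENNReal.ofReal_natCast]
      _ < ENNReal.ofReal (g b ω * l ‖x b - u‖) :=
          (ENNReal.ofReal_lt_ofReal_iff (hpos.trans_lt h1)).2 h1
  intro h0
  exact mul_ne_zero hgb hM (hind ▸ measure_mono_null hsub h0)

/-! ### Averaging over the Poisson configuration -/

theorem IsIrregularRayleighNetwork.measure_lt_SINR_eq_lintegral {d : ℕ} {Ω : Type*}
    [MeasurableSpace Ω] {P : Measure Ω} [IsProbabilityMeasure P] {lam μ : ℝ}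
    {X : ℕ → Ω → EuclideanSpace ℝ (Fin d)} {g : ℕ → Ω → ℝ}
    (hnet : IsIrregularRayleighNetwork P lam μ X g) {l : ℝ → ℝ} (hl : Measurable l) (σ T : ℝ)
    (u : EuclideanSpace ℝ (Fin d)) :
    P {ω | ENNReal.ofReal T < SINR l σ u (fun n => X n ω) (fun n => g n ω)}
      = ∫⁻ ω, P {ω' | ENNReal.ofReal T < SINR l σ u (fun n => X n ω) (fun n => g n ω')} ∂P :=
  measure_prodMk_mem_eq_lintegral (measurable_pi_lambda _ hnet.locations.measurable)
    (measurable_pi_lambda _ hnet.fading_measurable) hnet.fading_indep_locations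
    (measurableSet_lt measurable_const (measurable_SINR hl σ u))

theorem IsIrregularRayleighNetwork.coverageProb_pos {d : ℕ} {Ω : Type*}
    [MeasurableSpace Ω] {P : Measure Ω} [IsProbabilityMeasure P] {lam μ : ℝ} (hlam : 0 < lam)
    (hμ : 0 < μ) {X : ℕ → Ω → EuclideanSpace ℝ (Fin d)} {g : ℕ → Ω → ℝ}
    (hnet : IsIrregularRayleighNetwork P lam μ X g) {h α : ℝ} (hh : h ≠ 0) (hα : (d : ℝ) < α)
    (σ : ℝ) {T : ℝ} (hT : 0 < T) (u : EuclideanSpace ℝ (Fin d)) :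
    0 < coverageProb P (pathLoss h α) σ u X g T := by
  refine ENNReal.toReal_pos ?_ (measure_ne_top _ _)
  rw [hnet.measure_lt_SINR_eq_lintegral (measurable_pathLoss h α)]
  have htail : ∀ K, expMeasure μ (Set.Ioi K) ≠ 0 := fun K => by
    refine ne_of_gt (lt_of_lt_of_le ?_
      (measure_mono (Set.Ioi_subset_Ioi (le_max_left K 0))))
    rw [expMeasure_Ioi hμ (le_max_right K 0)]
    exact ENNReal.ofReal_pos.2 (Real.exp_pos _)
  intro hzero
  have hmeas : Measurable fun ω =>
      P {ω' | ENNReal.ofReal T < SINR (pathLoss h α) σ u (fun n => X n ω) (fun n => g n ω')} := by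
    have hS : MeasurableSet {p : (ℕ → EuclideanSpace ℝ (Fin d)) × Ω |
        ENNReal.ofReal T < SINR (pathLoss h α) σ u p.1 (fun n => g n p.2)} :=
      measurableSet_lt measurable_const ((measurable_SINR (measurable_pathLoss h α) σ u).comp
        (measurable_fst.prodMk ((measurable_pi_lambda _ hnet.fading_measurable).comp
          measurable_snd)))
    exact (measurable_measure_prodMk_left hS).comp
      (measurable_pi_lambda _ hnet.locations.measurable)
  rw [lintegral_eq_zero_iff hmeas] at hzero
  obtain ⟨ω, h1, h2⟩ :=
    (hzero.and (hnet.locations.ae_tsum_pathLoss_ne_top hlam hh hα u)).exists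
  exact measure_lt_SINR_ne_zero hnet.fading_measurable hnet.fading_law hnet.fading_indep
    (lintegral_ofReal_expMeasure_ne_top hμ) htail (pathLoss_pos hh α) σ hT u h2 h1

/-- The terms bound, in this order, the probability that at most `k` stations lie within distance
`1` of the user, and the conditional coverage probability when there are more. -/
theorem IsIrregularRayleighNetwork.measure_lt_SINR_le {d : ℕ} {Ω : Type*}
    [MeasurableSpace Ω] {P : Measure Ω} [IsProbabilityMeasure P] {lam μ : ℝ}
    {X : ℕ → Ω → EuclideanSpace ℝ (Fin d)} {g : ℕ → Ω → ℝ}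
    (hnet : IsIrregularRayleighNetwork P lam μ X g) {h α : ℝ} (hh : h ≠ 0) (hα : 0 ≤ α)
    (σ : ℝ) {T : ℝ} (hT : 0 < T) (u : EuclideanSpace ℝ (Fin d)) (k : ℕ) {M : ℝ} (hM : 0 ≤ M) :
    P {ω | ENNReal.ofReal T < SINR (pathLoss h α) σ u (fun n => X n ω) (fun n => g n ω)}
      ≤ poissonMeasure (Real.toNNReal (lam * volume.real (Metric.ball u 1))) (Set.Iic k)
        + (expMeasure μ (Set.Ioi M)
          + expMeasure μ (Set.Iic (M * pathLoss h α 0 / (T * pathLoss h α 1))) ^ k) := by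
  set C := expMeasure μ (Set.Ioi M)
    + expMeasure μ (Set.Iic (M * pathLoss h α 0 / (T * pathLoss h α 1))) ^ k
  have hlaw := hnet.locations.count_hasLaw (Metric.ball u 1) measurableSet_ball measure_ball_lt_top
  set F := {ω | pointCount (fun n => X n ω) (Metric.ball u 1) ≤ (k : ℕ∞)} with hF
  have hlL : ∀ r, pathLoss h α r ≤ pathLoss h α 0 := fun r => by
    -- `pathLoss` depends on `r` only through `r ^ 2`, so `r` may be taken nonnegative.
    rw [pathLoss, ← sq_abs r, ← pathLoss]
    exact pathLoss_anti hh hα le_rfl (abs_nonneg r)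
  have hPF : P F = poissonMeasure (Real.toNNReal (lam * volume.real (Metric.ball u 1)))
      (Set.Iic k) := by
    rw [hF, hlaw.measure_eq (p := fun m => m ≤ (k : ℕ∞)) (Set.to_countable _).measurableSet,
      Measure.map_apply (measurable_of_countable _) (Set.to_countable _).measurableSet]
    congr 1
    ext n
    simp
  have hpoint : ∀ ω, P {ω' | ENNReal.ofReal T
      < SINR (pathLoss h α) σ u (fun n => X n ω) (fun n => g n ω')} ≤ F.indicator 1 ω + C := by
    intro ω
    by_cases hω : ω ∈ F
    · rw [Set.indicator_of_mem hω]
      exact prob_le_one.trans le_self_add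
    · exact (CellularNetwork.measure_lt_SINR_le hnet.fading_law hnet.fading_indep
        (pathLoss_pos hh α 0) (pathLoss_pos hh α 1)
        (fun r => (pathLoss_pos hh α r).le) hlL (fun r hr => pathLoss_anti hh hα hr) σ hT u
        (not_le.1 hω) hM).trans le_add_self
  rw [hnet.measure_lt_SINR_eq_lintegral (measurable_pathLoss h α), ← hPF]
  calc ∫⁻ ω, P {ω' | ENNReal.ofReal T
        < SINR (pathLoss h α) σ u (fun n => X n ω) (fun n => g n ω')} ∂P
      ≤ ∫⁻ ω, (F.indicator 1 ω + C) ∂P := lintegral_mono hpoint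
    _ ≤ P F + C := by
        rw [lintegral_add_right _ measurable_const, lintegral_const, measure_univ, mul_one]
        gcongr
        exact lintegral_indicator_one_le F

theorem tendsto_coverageProb_atTop {d : ℕ} {α h μ : ℝ} (hα : 0 ≤ α) (hh : h ≠ 0) (hμ : 0 < μ)
    (σ : ℝ) {T : ℝ} (hT : 0 < T) (u : EuclideanSpace ℝ (Fin d))
    {Ω : ℝ → Type*} [∀ lam, MeasurableSpace (Ω lam)] {P : ∀ lam, Measure (Ω lam)}
    [∀ lam, IsProbabilityMeasure (P lam)]
    {X : ∀ lam, ℕ → Ω lam → EuclideanSpace ℝ (Fin d)} {g : ∀ lam, ℕ → Ω lam → ℝ}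
    (hnet : ∀ lam : ℝ, 0 < lam → IsIrregularRayleighNetwork (P lam) lam μ (X lam) (g lam)) :
    Tendsto (fun lam => coverageProb (P lam) (pathLoss h α) σ u (X lam) (g lam) T)
      atTop (𝓝 0) := by
  have := isProbabilityMeasure_expMeasure hμ
  rw [← ENNReal.toReal_zero]
  refine (ENNReal.tendsto_toReal ENNReal.zero_ne_top).comp ?_
  rw [ENNReal.tendsto_nhds_zero]
  intro ε hε
  have hε3 : 0 < ε / 3 := ENNReal.div_pos hε.ne' (by simp)
  obtain ⟨M, hMε, hM⟩ : ∃ M : ℝ, expMeasure μ (Set.Ioi M) ≤ ε / 3 ∧ 0 ≤ M := by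
    have hlim : Tendsto (fun M => ENNReal.ofReal (Real.exp (-(μ * M)))) atTop (𝓝 0) := by
      rw [← ENNReal.ofReal_zero]
      exact ENNReal.tendsto_ofReal (Real.tendsto_exp_neg_atTop_nhds_zero.comp
        (tendsto_id.const_mul_atTop hμ))
    obtain ⟨M, h1, h2⟩ :=
      ((ENNReal.tendsto_nhds_zero.1 hlim _ hε3).and (eventually_ge_atTop 0)).exists
    exact ⟨M, (expMeasure_Ioi hμ h2).trans_le h1, h2⟩
  set K := M * pathLoss h α 0 / (T * pathLoss h α 1) with hK
  have hK0 : 0 ≤ K := by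
    have := pathLoss_pos hh α 0
    have := pathLoss_pos hh α 1
    positivity
  -- `M` is fixed, hence so is `K`; now the number `k` of interferers is chosen.
  have hq : expMeasure μ (Set.Iic K) < 1 := by
    rw [← Set.compl_Ioi, prob_compl_eq_one_sub measurableSet_Ioi, expMeasure_Ioi hμ hK0]
    exact ENNReal.sub_lt_self ENNReal.one_ne_top one_ne_zero
      (ENNReal.ofReal_pos.2 (Real.exp_pos _)).ne'
  obtain ⟨k, hk⟩ := (ENNReal.tendsto_nhds_zero.1
    (ENNReal.tendsto_pow_atTop_nhds_zero_of_lt_one hq) _ hε3).exists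
  have hvol : 0 < volume.real (Metric.ball u 1) :=
    ENNReal.toReal_pos (Metric.measure_ball_pos _ _ one_pos).ne' measure_ball_lt_top.ne
  have hmean : Tendsto (fun lam : ℝ => Real.toNNReal (lam * volume.real (Metric.ball u 1)))
      atTop atTop :=
    Real.tendsto_toNNReal_atTop.comp (tendsto_id.atTop_mul_const hvol)
  filter_upwards [eventually_gt_atTop 0,
    ENNReal.tendsto_nhds_zero.1 ((tendsto_poissonMeasure_Iic_atTop k).comp hmean) _ hε3]
    with lam hlam hpois
  calc P lam {ω | ENNReal.ofReal T
        < SINR (pathLoss h α) σ u (fun n => X lam n ω) (fun n => g lam n ω)}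
      ≤ _ := (hnet lam hlam).measure_lt_SINR_le hh hα σ hT u k hM
    _ ≤ ε / 3 + (ε / 3 + ε / 3) := add_le_add hpois (add_le_add hMε hk)
    _ = ε := by rw [← add_assoc, ENNReal.add_thirds]

end CellularNetwork

theorem theorem1 (d : ℕ) (hd : d = 1 ∨ d = 2) (α : ℝ) (hα : (d : ℝ) < α) (h : ℝ) (hh : h ≠ 0)
    (μ : ℝ) (hμ : 0 < μ) (σ : ℝ) (T : ℝ) (hT : 0 < T) (u : EuclideanSpace ℝ (Fin d))
    {Ω : ℝ → Type*} [∀ lam, MeasurableSpace (Ω lam)] (P : ∀ lam, Measure (Ω lam))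
    [∀ lam, IsProbabilityMeasure (P lam)]
    (X : ∀ lam, ℕ → Ω lam → EuclideanSpace ℝ (Fin d)) (g : ∀ lam, ℕ → Ω lam → ℝ)
    (hnet : ∀ lam : ℝ, 0 < lam →
      CellularNetwork.IsIrregularRayleighNetwork (P lam) lam μ (X lam) (g lam)) :
    Tendsto (fun lam => CellularNetwork.coverageProb (P lam) (CellularNetwork.pathLoss h α) σ u
      (X lam) (g lam) T) atTop (𝓝 0) ∧
    ¬ CellularNetwork.SINRInvariant (fun lam => CellularNetwork.coverageProb (P lam)
      (CellularNetwork.pathLoss h α) σ u (X lam) (g lam) T) := by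
  have hlim := CellularNetwork.tendsto_coverageProb_atTop
    ((Nat.cast_nonneg d).trans hα.le) hh hμ σ hT u hnet
  refine ⟨hlim, ?_⟩
  rintro ⟨c, hc⟩
  have hc0 : c = 0 := by
    refine tendsto_nhds_unique (tendsto_const_nhds.congr' ?_) hlim
    filter_upwards [eventually_gt_atTop 0] with lam hlam using (hc lam hlam).symm
  have hpos := (hnet 1 one_pos).coverageProb_pos one_pos hμ hh hα σ hT u
  exact hpos.ne' ((hc 1 one_pos).trans hc0)
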